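/- For integers $d,n\ge 1$ and a real number $r>0$, the random geometric graph $G_d(n,r)$ has $n$ vertices $1,\dots,n$ and is obtained from $n$ independent uniformly distributed random points $X_1,\dots,X_n$ of $[0,1]^d$ by joining distinct $i,j$ if and only if $\lVert X_i-X_j\rVert\le r$, where $\lVert\cdot\rVert$ is the Euclidean norm. For $\alpha\in[0,1]$, an $\alpha$-subgraph of a graph $G$ is a spanning subgraph $H\subseteq G$ such that $d_H(v)\ge\alpha\, d_G(v)$ for every vertex $v$ of $G$. A graph is Hamiltonian if it contains a cycle through all of its vertices. Let $\theta_d$ be the volume of the unit ball of $\mathbb{R}^d$ and $\log$ the natural logarithm. **Theorem.** For every integer $d\ge 1$ and every $\epsilon\in\bigl(0,\tfrac{1}{2d^{d/2}\theta_d}\bigr]$ there exists a constant $C_4=C_4(d,\epsilon)>0$ such that the following holds. Let $r=r(n)$ be any sequence of real numbers with $r(n)\to 0$ as $n\to\infty$ and $r(n)\ge C_4(\log n/n)^{1/d}$ for all sufficiently large $n$. Then the probability that every $\bigl(1-\tfrac{1}{2d^{d/2}\theta_d}+\epsilon\bigr)$-subgraph of $G_d(n,r(n))$ is Hamiltonian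 tends to $1$ as $n\to\infty$. -/

import Mathlib

open MeasureTheory Filter Topology

noncomputable section

/-- The volume of the unit ball in `d`-dimensional Euclidean space. -/
def unitBallVolume (d : ℕ) : ℝ :=
  (volume (Metric.ball (0 : EuclideanSpace ℝ (Fin d)) 1)).toReal

/-- The cube `[0,1]^d`, as a subset of `d`-dimensional Euclidean space. -/
def unitCube (d : ℕ) : Set (EuclideanSpace ℝ (Fin d)) :=
  {x | ∀ i, x i ∈ Set.Icc (0 : ℝ) 1}

/-- The uniform distribution on `[0,1]^d`: Lebesgue measure conditioned on the cube. -/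
def uniformCube (d : ℕ) : Measure (EuclideanSpace ℝ (Fin d)) :=
  ProbabilityTheory.cond volume (unitCube d)

/-- The joint law of `n` mutually independent uniform random points of `[0,1]^d`. -/
def uniformPoints (d n : ℕ) : Measure (Fin n → EuclideanSpace ℝ (Fin d)) :=
  Measure.pi fun _ => uniformCube d

/-- The geometric graph of the points `x 0, …, x (n-1)`: distinct `i` and `j` are adjacent exactly
when the Euclidean distance of `x i` and `x j` is at most `r`. If `x` is distributed according to
`uniformPoints d n`, this is the random geometric graph `G_d(n,r)`. -/
def geometricGraph {d n : ℕ} (r : ℝ) (x : Fin n → EuclideanSpace ℝ (Fin d)) :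
    SimpleGraph (Fin n) where
  Adj i j := i ≠ j ∧ ‖x i - x j‖ ≤ r
  symm := ⟨fun i j h => ⟨h.1.symm, by rw [norm_sub_rev]; exact h.2⟩⟩
  loopless := ⟨fun _ h => h.1 rfl⟩

open Classical in
/-- `H` is an `α`-subgraph of `G`: a (spanning) subgraph in which every vertex keeps at least an
`α`-proportion of its degree. -/
def IsAlphaSubgraph {V : Type*} [Fintype V] (α : ℝ) (H G : SimpleGraph V) : Prop :=
  H ≤ G ∧ ∀ v : V, α * (G.degree v : ℝ) ≤ (H.degree v : ℝ)

lemma volume_unitCube (d : ℕ) : volume (unitCube d) = 1 := by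
  have h : unitCube d = (WithLp.ofLp : EuclideanSpace ℝ (Fin d) → Fin d → ℝ) ⁻¹'
      (Set.univ.pi fun _ => Set.Icc (0 : ℝ) 1) := by
    ext x; simp [unitCube, Pi.le_def, forall_and]
  rw [h, (PiLp.volume_preserving_ofLp (Fin d)).measure_preimage
    (MeasurableSet.univ_pi fun _ => measurableSet_Icc).nullMeasurableSet, volume_pi_pi]
  simp

instance (d : ℕ) : IsProbabilityMeasure (uniformCube d) :=
  ProbabilityTheory.cond_isProbabilityMeasure_of_finite (by rw [volume_unitCube]; exact one_ne_zero)
    (by rw [volume_unitCube]; exact ENNReal.one_ne_top)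

instance (d n : ℕ) : IsProbabilityMeasure (uniformPoints d n) := by
  unfold uniformPoints; infer_instance

end

/-
Cut the cube into `L ^ d` cells of side `1 / L` slightly below `r / √d`. Then each cell, and the
union of the facing halves of two adjacent cells, has diameter at most `r`. By Chernoff bounds
every half-cell receives about `n / (2 * L ^ d) ≈ n * r ^ d / (2 * √d ^ d)` points, while no
degree much exceeds `θ_d * n * r ^ d`. Passing to an `α`-subgraph with
`1 - α < 1 / (2 * √d ^ d * θ_d)` therefore deletes fewer edges at each vertex than a half-cell has
points. Consequently every cell remains Hamilton-connected by Ore's theorem, even after the loss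
of three vertices, and adjacent cells remain linked. Along a boustrophedon through the grid, a
Hamilton path of all later cells is inserted into a Hamilton path of the current one; in the first
cell the endpoints are taken adjacent, which closes the cycle.
-/

section HamiltonPaths

variable {V : Type*}

open Classical in
/-- The number of consecutive pairs of a list that are not related by `R`: its distance from being
an `R`-chain. -/
noncomputable def chainDefect (R : V → V → Prop) : List V → ℕ
  | a :: b :: l => (if R a b then 0 else 1) + chainDefect R (b :: l)
  | _ => 0

open Classical in
lemma isChain_of_chainDefect_eq_zero {R : V → V → Prop} :
    ∀ {l : List V}, chainDefect R l = 0 → l.IsChain R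
  | [], _ => .nil
  | [a], _ => .singleton a
  | a :: b :: l, h => by
    rw [chainDefect, Nat.add_eq_zero_iff, ite_eq_left_iff] at h
    exact .cons_cons (by_contra fun hab => one_ne_zero (h.1 hab))
      (isChain_of_chainDefect_eq_zero h.2)

open Classical in
lemma chainDefect_append (R : V → V → Prop) (l₂ : List V) : ∀ l₁ : List V,
    chainDefect R (l₁ ++ l₂) = chainDefect R l₁ +
      (if ∀ a ∈ l₁.getLast?, ∀ b ∈ l₂.head?, R a b then 0 else 1) + chainDefect R l₂
  | [] => by simp [chainDefect]
  | [a] => by cases l₂ <;> simp [chainDefect]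
  | a :: b :: l => by
    have ih := chainDefect_append R l₂ (b :: l)
    rw [List.cons_append] at ih
    rw [List.cons_append, List.cons_append, chainDefect, ih, chainDefect, List.getLast?_cons_cons]
    ring

open Classical in
lemma chainDefect_reverse {R : V → V → Prop} (hR : Std.Symm R) :
    ∀ l : List V, chainDefect R l.reverse = chainDefect R l
  | [] => rfl
  | [a] => rfl
  | a :: b :: l => by
    rw [List.reverse_cons, chainDefect_append, chainDefect_reverse hR (b :: l)]
    simp [chainDefect, comm_of R, add_comm]

/-- The exchange step of Ore's theorem: reversing `M` replaces the junctions `a a'` and `b b'` by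
`a b` and `a' b'`. -/
lemma chainDefect_reverse_middle_lt {R : V → V → Prop} (hR : Std.Symm R) {P M Q : List V}
    {a a' b b' : V} (ha : P.getLast? = some a) (ha' : M.head? = some a')
    (hb : M.getLast? = some b) (hb' : Q.head? = some b') (hab : R a b) (hab' : R a' b')
    (hbad : ¬ R a a' ∨ ¬ R b b') :
    chainDefect R (P ++ (M.reverse ++ Q)) < chainDefect R (P ++ (M ++ Q)) := by
  classical
  have hlt : 0 < (if R a a' then 0 else 1) + if R b b' then 0 else 1 := by
    rcases hbad with h | h <;> simp [h]
  simp only [chainDefect_append, chainDefect_reverse hR, List.head?_append, List.head?_reverse,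
    List.getLast?_reverse, ha, ha', hb, hb', Option.some_or, Option.mem_def, Option.some.injEq,
    forall_eq', hab, hab', if_true]
  omega

lemma exists_perm_chainDefect_lt {R : V → V → Prop} (hR : Std.Symm R) {l : List V} {i j : ℕ}
    (hij : i < j) {a a' b b' : V} (ha : l[i]? = some a) (ha' : l[i + 1]? = some a')
    (hb : l[j]? = some b) (hb' : l[j + 1]? = some b') (hab : R a b) (hab' : R a' b')
    (hbad : ¬ R a a' ∨ ¬ R b b') :
    ∃ l' : List V, l'.Perm l ∧ l'.head? = l.head? ∧ l'.getLast? = l.getLast? ∧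
      chainDefect R l' < chainDefect R l := by
  obtain ⟨P, M, Q, rfl, hP, hM⟩ : ∃ P M Q, l = P ++ (M ++ Q) ∧ P.length = i + 1 ∧
      M.length = j - i := by
    have hj : j < l.length := (List.getElem?_eq_some_iff.1 hb).1
    refine ⟨l.take (i + 1), (l.drop (i + 1)).take (j - i), (l.drop (i + 1)).drop (j - i),
      ?_, ?_, ?_⟩
    · rw [List.take_append_drop, List.take_append_drop]
    · simp; omega
    · simp; omega
  have hPlast : P.getLast? = some a := by
    rw [List.getLast?_eq_getElem?, hP, ← ha, List.getElem?_append_left (by omega)]; simp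
  have hMhead : M.head? = some a' := by
    rw [List.head?_eq_getElem?, ← ha', List.getElem?_append_right (by omega),
      List.getElem?_append_left (by omega), hP, Nat.sub_self]
  have hMlast : M.getLast? = some b := by
    rw [List.getLast?_eq_getElem?, ← hb, List.getElem?_append_right (by omega),
      List.getElem?_append_left (by omega), hP, hM]
    congr 1
  have hQhead : Q.head? = some b' := by
    rw [List.head?_eq_getElem?, ← hb', List.getElem?_append_right (by omega),
      List.getElem?_append_right (by omega)]
    congr 1; omega
  refine ⟨P ++ (M.reverse ++ Q), (M.reverse_perm.append_right Q).append_left P, ?_, ?_,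
    chainDefect_reverse_middle_lt hR hPlast hMhead hMlast hQhead hab hab' hbad⟩
  · cases P <;> simp at hP ⊢
  · cases Q <;> simp [List.getLast?_append, List.getLast?_cons] at hQhead ⊢

open Classical in
lemma exists_adj_adj_succ {G : SimpleGraph V} {l : List V} {i : ℕ} {x y : V}
    (hx : l[i]? = some x) (hy : l[i + 1]? = some y)
    (hcard : l.length < (l.toFinset.filter (G.Adj x)).card + (l.toFinset.filter (G.Adj y)).card) :
    ∃ j ≠ i, ∃ b b', l[j]? = some b ∧ l[j + 1]? = some b' ∧ G.Adj x b ∧ G.Adj y b' := by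
  have hinj : ∀ z, Set.InjOn (l.idxOf ·) (l.toFinset.filter (G.Adj z)) := fun z a ha b _ hab =>
    (List.idxOf_inj (by simpa using (Finset.mem_filter.1 ha).1)).1 hab
  set A := (l.toFinset.filter (G.Adj x)).image (l.idxOf · + 1)
  set B := (l.toFinset.filter (G.Adj y)).image (l.idxOf ·)
  have hA : A.card = (l.toFinset.filter (G.Adj x)).card :=
    Finset.card_image_of_injOn fun a ha b hb hab => hinj x ha hb (Nat.succ_injective hab)
  have hB : B.card = (l.toFinset.filter (G.Adj y)).card := Finset.card_image_of_injOn (hinj y)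
  have hi : i + 1 < l.length := (List.getElem?_eq_some_iff.1 hy).1
  have hidx : ∀ {b k}, b ∈ l → l.idxOf b = k → l[k]? = some b := by
    rintro b _ hb rfl; exact List.getElem?_idxOf hb
  have hAsub : A ⊆ (Finset.range (l.length + 1)).erase (i + 1) := by
    intro k hk
    obtain ⟨b, hb, rfl⟩ := Finset.mem_image.1 hk
    rw [Finset.mem_filter, List.mem_toFinset] at hb
    have := List.idxOf_lt_length_of_mem hb.1
    refine Finset.mem_erase.2 ⟨fun h => hb.2.ne ?_, by simpa⟩
    simpa [hx] using hidx hb.1 (Nat.succ_injective h)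
  have hBsub : B ⊆ (Finset.range (l.length + 1)).erase (i + 1) := by
    intro k hk
    obtain ⟨b, hb, rfl⟩ := Finset.mem_image.1 hk
    rw [Finset.mem_filter, List.mem_toFinset] at hb
    have := List.idxOf_lt_length_of_mem hb.1
    refine Finset.mem_erase.2 ⟨fun h => hb.2.ne ?_, by simp; omega⟩
    simpa [hy] using hidx hb.1 h
  obtain ⟨k, hk⟩ := Finset.inter_nonempty_of_card_lt_card_add_card hAsub hBsub (by
    rw [Finset.card_erase_of_mem (by simp; omega), hA, hB]; simpa)
  obtain ⟨hkA, hkB⟩ := Finset.mem_inter.1 hk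
  obtain ⟨b, hb, rfl⟩ := Finset.mem_image.1 hkA
  obtain ⟨b', hb', hbb'⟩ := Finset.mem_image.1 hkB
  rw [Finset.mem_filter, List.mem_toFinset] at hb hb'
  refine ⟨l.idxOf b, fun h => ?_, b, b', hidx hb.1 rfl, hidx hb'.1 hbb', hb.2, hb'.2⟩
  exact (Finset.mem_erase.1 (hAsub hkA)).1 (by rw [h])

/-- `l` is the vertex list of a path of `G` whose vertex set is `S`. -/
structure IsPathOn (G : SimpleGraph V) (S : Set V) (l : List V) : Prop where
  nodup : l.Nodup
  mem_iff : ∀ x, x ∈ l ↔ x ∈ S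
  isChain : l.IsChain G.Adj

/-- `G` has a path from `u` to `v` whose vertex set is `S`. -/
def HasPathOn (G : SimpleGraph V) (S : Set V) (u v : V) : Prop :=
  ∃ l, IsPathOn G S l ∧ l.head? = some u ∧ l.getLast? = some v

open Classical in
/-- A path is found as a list with the least `chainDefect` among the enumerations of `S` from `u` to
`v`: at a defect, a degree count gives an exchange that lowers it. -/
lemma hasPathOn_of_ore {G : SimpleGraph V} {S : Finset V}
    (hS : ∀ x ∈ S, ∀ y ∈ S, x ≠ y → ¬ G.Adj x y →
      S.card < (S.filter (G.Adj x)).card + (S.filter (G.Adj y)).card)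
    {u v : V} (hu : u ∈ S) (hv : v ∈ S) (huv : u ≠ v) : HasPathOn G S u v := by
  let IsList (l : List V) := l.Nodup ∧ l.toFinset = S ∧ l.head? = some u ∧ l.getLast? = some v
  have hex : ∃ l, IsList l := by
    refine ⟨u :: (((S.erase u).erase v).toList ++ [v]), ?_, ?_, rfl, by simp [List.getLast?_cons]⟩
    · simp +contextual [List.nodup_append, Finset.nodup_toList, huv]
    · ext x
      by_cases hxu : x = u <;> by_cases hxv : x = v <;> simp [hxu, hxv, hu, hv]
  obtain ⟨l, ⟨hl, rfl, hhead, hlast⟩, hmin⟩ :=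
    exists_minimalFor_of_wellFoundedLT IsList (chainDefect G.Adj) hex
  refine ⟨l, ⟨hl, by simp, by_contra fun hchain => ?_⟩, hhead, hlast⟩
  obtain ⟨i, hi, hbad⟩ := List.exists_not_getElem_of_not_isChain hchain
  have hne : l[i] ≠ l[i + 1] := fun h => by have := hl.getElem_inj_iff.1 h; omega
  have hcard := hS _ (by simp) _ (by simp) hne hbad
  rw [List.toFinset_card_of_nodup hl] at hcard
  have hi₀ : l[i]? = some l[i] := List.getElem?_eq_getElem (by omega)
  have hi₁ : l[i + 1]? = some l[i + 1] := List.getElem?_eq_getElem hi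
  have hsymm : Std.Symm G.Adj := G.symm
  obtain ⟨j, hji, b, b', hb, hb', hab, hab'⟩ := exists_adj_adj_succ hi₀ hi₁ hcard
  obtain ⟨l', hperm, hhead', hlast', hlt⟩ : ∃ l' : List V, l'.Perm l ∧ l'.head? = l.head? ∧
      l'.getLast? = l.getLast? ∧ chainDefect G.Adj l' < chainDefect G.Adj l := by
    rcases hji.lt_or_gt with hji | hij
    · exact exists_perm_chainDefect_lt hsymm hji hb hb' hi₀ hi₁ hab.symm hab'.symm (.inr hbad)
    · exact exists_perm_chainDefect_lt hsymm hij hi₀ hi₁ hb hb' hab hab' (.inl hbad)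
  exact hlt.not_ge (hmin ⟨hperm.nodup_iff.2 hl, List.toFinset_eq_of_perm _ _ hperm,
    hhead'.trans hhead, hlast'.trans hlast⟩ hlt.le)

lemma isHamiltonian_of_hasPathOn [Fintype V] [DecidableEq V] {G : SimpleGraph V} {u v : V}
    (h : HasPathOn G Set.univ u v) (huv : G.Adj u v) (hcard : 3 ≤ Fintype.card V) :
    G.IsHamiltonian := by
  intro _
  obtain ⟨l, ⟨hnodup, hmem, hchain⟩, hhead, hlast⟩ := h
  have hne : l ≠ [] := by rintro rfl; simp at hhead
  rw [List.head?_eq_some_head hne, Option.some_inj] at hhead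
  rw [List.getLast?_eq_some_getLast hne, Option.some_inj] at hlast
  let p : G.Walk u v := (SimpleGraph.Walk.ofSupport l hne hchain).copy hhead hlast
  have hp : p.support = l := by simp [p, SimpleGraph.Walk.support_ofSupport]
  have hpath : p.IsPath := by rwa [SimpleGraph.Walk.isPath_def, hp]
  have hham : p.IsHamiltonian := hpath.isHamiltonian_iff.2 fun w => by simp [hp, hmem]
  have hlen : p.length ≠ 1 := by rw [hham.length_eq]; omega
  refine ⟨v, .cons huv.symm p, ?_⟩
  rw [SimpleGraph.Walk.isHamiltonianCycle_isCycle_and_isHamiltonian_tail]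
  refine ⟨SimpleGraph.Walk.cons_isCycle_iff _ _ |>.2 ⟨hpath, fun he => ?_⟩, by
    simpa [SimpleGraph.Walk.IsHamiltonian] using hham⟩
  exact hlen (hpath.length_eq_one_of_mem_edges (Sym2.eq_swap ▸ he))

end HamiltonPaths

section DenseCells

variable {V : Type*} {G : SimpleGraph V}

lemma HasPathOn.append {S T : Set V} {u v x y : V} (h₁ : HasPathOn G S u v)
    (h₂ : HasPathOn G T x y) (hST : Disjoint S T) (hvx : G.Adj v x) :
    HasPathOn G (S ∪ T) u y := by
  obtain ⟨l₁, ⟨hnodup₁, hmem₁, hchain₁⟩, hhead₁, hlast₁⟩ := h₁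
  obtain ⟨l₂, ⟨hnodup₂, hmem₂, hchain₂⟩, hhead₂, hlast₂⟩ := h₂
  refine ⟨l₁ ++ l₂, ⟨hnodup₁.append hnodup₂ fun z hz₁ hz₂ => ?_, fun z => ?_,
    hchain₁.append hchain₂ ?_⟩, by simp [hhead₁], by simp [hlast₂]⟩
  · exact Set.disjoint_left.1 hST ((hmem₁ z).1 hz₁) ((hmem₂ z).1 hz₂)
  · rw [List.mem_append, hmem₁, hmem₂, Set.mem_union]
  · simpa [hlast₁, hhead₂] using hvx

lemma hasPathOn_triple {u w a : V} (huw : G.Adj u w) (hwa : G.Adj w a) (hua : u ≠ a) :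
    HasPathOn G {u, w, a} u a :=
  ⟨[u, w, a], ⟨by simp [huw.ne, hwa.ne, hua], by simp, by simp [huw, hwa]⟩, rfl, rfl⟩

open Classical in
/-- `B` is nonempty and `G` has minimum degree at least `|B| / 2 + 2` on `B`, so that `B` stays
Hamilton-connected after the deletion of up to three vertices. -/
structure IsDenseCell (G : SimpleGraph V) (B : Finset V) : Prop where
  nonempty : B.Nonempty
  card_add_four_le : ∀ x ∈ B, B.card + 4 ≤ 2 * (B.filter (G.Adj x)).card

open Classical in
/-- A Hamilton path of the cell `B'` between two vertices of `P` can be inserted into a Hamilton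
path of the cell `B`. -/
def AreLinked (G : SimpleGraph V) (B B' : Finset V) : Prop :=
  ∃ P ⊆ B', 2 ≤ P.card ∧ ∀ x ∈ P, 4 ≤ (B.filter (G.Adj x)).card

variable {B : Finset V}

open Classical in
lemma IsDenseCell.hasPathOn_sdiff (hB : IsDenseCell G B) {T : Finset V} (hT : T.card ≤ 3)
    {u v : V} (hu : u ∈ B \ T) (hv : v ∈ B \ T) (huv : u ≠ v) :
    HasPathOn G (B \ T : Finset V) u v := by
  refine hasPathOn_of_ore (fun x hx y hy _ _ => ?_) hu hv huv
  have hdeg : ∀ z ∈ B \ T, B.card + 4 ≤ 2 * (((B \ T).filter (G.Adj z)).card + (B ∩ T).card) := by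
    intro z hz
    have hsub : B.filter (G.Adj z) ⊆ (B \ T).filter (G.Adj z) ∪ B ∩ T := by
      intro w hw
      by_cases hwT : w ∈ T <;> simp_all
    have := hB.card_add_four_le z (Finset.mem_sdiff.1 hz).1
    have := (Finset.card_le_card hsub).trans (Finset.card_union_le _ _)
    omega
  have := hdeg x hx
  have := hdeg y hy
  have := Finset.card_sdiff_add_card_inter B T
  have : (B ∩ T).card ≤ 3 := (Finset.card_le_card Finset.inter_subset_right).trans hT
  omega

lemma IsDenseCell.exists_common_adj (hB : IsDenseCell G B) {u a : V} (hu : u ∈ B) (ha : a ∈ B)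
    {T : Finset V} (hT : T.card ≤ 3) : ∃ w ∈ B, w ∉ T ∧ G.Adj u w ∧ G.Adj a w := by
  classical
  have := hB.card_add_four_le u hu
  have := hB.card_add_four_le a ha
  have := Finset.card_union_add_card_inter (B.filter (G.Adj u)) (B.filter (G.Adj a))
  have := Finset.card_le_card (Finset.union_subset (B.filter_subset (G.Adj u))
    (B.filter_subset (G.Adj a)))
  obtain ⟨w, hw, hwT⟩ := Finset.exists_mem_notMem_of_card_lt_card
    (show T.card < (B.filter (G.Adj u) ∩ B.filter (G.Adj a)).card by omega)
  simp only [Finset.mem_inter, Finset.mem_filter] at hw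
  exact ⟨w, hw.1.1, hwT, hw.1.2, hw.2.2⟩

open Classical in
lemma exists_adj_notMem {x : V} {T : Finset V} (hx : 4 ≤ (B.filter (G.Adj x)).card)
    (hT : T.card ≤ 3) : ∃ a ∈ B, G.Adj x a ∧ a ∉ T := by
  obtain ⟨a, ha, haT⟩ := Finset.exists_mem_notMem_of_card_lt_card (hT.trans_lt hx)
  rw [Finset.mem_filter] at ha
  exact ⟨a, ha.1, ha.2, haT⟩

open Classical in
/-- The path runs `u, w, a` inside `B`, then through `S` from `x` to `y`, and back in `B` from `b`
through all remaining vertices to `v`. -/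
lemma IsDenseCell.hasPathOn_union (hB : IsDenseCell G B) {S : Set V} {x y u v : V}
    (hS : HasPathOn G S x y) (hBS : Disjoint (B : Set V) S)
    (hx : 4 ≤ (B.filter (G.Adj x)).card) (hy : 4 ≤ (B.filter (G.Adj y)).card)
    (hu : u ∈ B) (hv : v ∈ B) (huv : u ≠ v) : HasPathOn G (B ∪ S) u v := by
  obtain ⟨a, haB, hxa, ha⟩ := exists_adj_notMem hx (T := {u, v})
    (Finset.card_le_two.trans (by simp))
  obtain ⟨b, hbB, hyb, hb⟩ := exists_adj_notMem hy (T := {u, v, a}) Finset.card_le_three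
  obtain ⟨w, hwB, hw, huw, haw⟩ := hB.exists_common_adj hu haB (T := {v, b})
    (Finset.card_le_two.trans (by simp))
  simp only [Finset.mem_insert, Finset.mem_singleton, not_or] at ha hb hw
  have htriple : HasPathOn G {u, w, a} u a := hasPathOn_triple huw haw.symm (Ne.symm ha.1)
  have hsub : ({u, w, a} : Set V) ⊆ B := by
    rintro z (rfl | rfl | rfl) <;> assumption
  have hrest : HasPathOn G (B \ {u, w, a} : Finset V) b v :=
    hB.hasPathOn_sdiff Finset.card_le_three (by simp [hbB, hb, Ne.symm hw.2])
      (by simp [hv, huv.symm, Ne.symm hw.1, Ne.symm ha.2]) hb.2.1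
  have hcover : (B ∪ S : Set V) = {u, w, a} ∪ S ∪ (B \ {u, w, a} : Finset V) := by
    rw [Set.union_right_comm, Finset.coe_sdiff]
    simp [Set.union_sdiff_cancel hsub]
  rw [hcover]
  refine (htriple.append hS (hBS.mono_left hsub) hxa.symm).append hrest ?_ hyb
  rw [Set.disjoint_union_left]
  refine ⟨?_, (hBS.mono_left (by simp)).symm⟩
  simp [Set.disjoint_sdiff_right]

lemma hasPathOn_of_isChain_areLinked : ∀ {B : Finset V} {Bs : List (Finset V)},
    (∀ C ∈ B :: Bs, IsDenseCell G C) → (B :: Bs).Pairwise Disjoint →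
    (B :: Bs).IsChain (AreLinked G) → ∀ {u v : V}, u ∈ B → v ∈ B → u ≠ v →
      HasPathOn G {x | ∃ C ∈ B :: Bs, x ∈ C} u v
  | B, [], hdense, _, _, u, v, hu, hv, huv => by
    classical
    simpa using (hdense B (by simp)).hasPathOn_sdiff (T := ∅) (by simp) (by simpa) (by simpa) huv
  | B, B' :: Bs, hdense, hdisj, hlink, u, v, hu, hv, huv => by
    obtain ⟨hdisjB, hdisj⟩ := List.pairwise_cons.1 hdisj
    obtain ⟨⟨P, hPB', hP₂, hP⟩, hlink⟩ := List.isChain_cons_cons.1 hlink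
    obtain ⟨x, hx, y, hy, hxy⟩ := Finset.one_lt_card.1 hP₂
    have ih := hasPathOn_of_isChain_areLinked (fun C hC => hdense C (List.mem_cons_of_mem _ hC))
      hdisj hlink (hPB' hx) (hPB' hy) hxy
    have hpath := (hdense B (by simp)).hasPathOn_union ih
      (Set.disjoint_left.2 fun z hz ⟨C, hC, hzC⟩ => Finset.disjoint_left.1 (hdisjB C hC) hz hzC)
      (hP x hx) (hP y hy) hu hv huv
    convert hpath using 1
    ext z; simp

lemma isHamiltonian_of_isChain_areLinked [Fintype V] [DecidableEq V] {Bs : List (Finset V)}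
    (hne : Bs ≠ []) (hdense : ∀ B ∈ Bs, IsDenseCell G B) (hdisj : Bs.Pairwise Disjoint)
    (hlink : Bs.IsChain (AreLinked G)) (hcover : ∀ x, ∃ B ∈ Bs, x ∈ B) : G.IsHamiltonian := by
  obtain ⟨B, Bs, rfl⟩ := List.exists_cons_of_ne_nil hne
  have hB := hdense B (by simp)
  obtain ⟨u, hu⟩ := hB.nonempty
  obtain ⟨v, hv, -, huv, -⟩ := hB.exists_common_adj hu hu (T := ∅) (by simp)
  obtain ⟨w, -, hwuv, -⟩ := hB.exists_common_adj hu hu (T := {u, v})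
    (Finset.card_le_two.trans (by simp))
  have hcard : 3 ≤ Fintype.card V := by
    simp only [Finset.mem_insert, Finset.mem_singleton, not_or] at hwuv
    rw [← Finset.card_eq_three.2 ⟨u, v, w, huv.ne, Ne.symm hwuv.1, Ne.symm hwuv.2, rfl⟩]
    exact Finset.card_le_univ _
  refine isHamiltonian_of_hasPathOn (u := u) (v := v) ?_ huv hcard
  convert hasPathOn_of_isChain_areLinked hdense hdisj hlink hu hv huv.ne
  exact (Set.eq_univ_of_forall hcover).symm

open Classical in
lemma card_le_card_filter_adj_add_degree_sdiff [Fintype V] {G H : SimpleGraph V} {Q : Finset V}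
    {u : V} (hQ : ∀ w ∈ Q, G.Adj u w) :
    Q.card ≤ (Q.filter (H.Adj u)).card + (G \ H).degree u := by
  rw [← Finset.card_filter_add_card_filter_not (s := Q) (H.Adj u),
    ← SimpleGraph.card_neighborFinset_eq_degree]
  gcongr
  intro w hw
  rw [Finset.mem_filter] at hw
  simpa using ⟨hQ w hw.1, hw.2⟩

open Classical in
lemma isDenseCell_of_isClique [Fintype V] {G H : SimpleGraph V} {D : ℕ} (hG : G.IsClique B)
    (hD : ∀ v, (G \ H).degree v ≤ D) (hB : 2 * D + 6 ≤ B.card) : IsDenseCell H B := by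
  refine ⟨Finset.card_pos.1 (by omega), fun x hx => ?_⟩
  have hadj : ∀ w ∈ B.erase x, G.Adj x w := fun w hw =>
    hG hx (Finset.mem_of_mem_erase hw) (Finset.ne_of_mem_erase hw).symm
  have := card_le_card_filter_adj_add_degree_sdiff (H := H) hadj
  have := Finset.card_erase_of_mem hx
  have := Finset.card_le_card (Finset.filter_subset_filter (H.Adj x) (Finset.erase_subset x B))
  have := hD x
  omega

open Classical in
lemma areLinked_of_forall_adj [Fintype V] {G H : SimpleGraph V} {D : ℕ} {B B' P Q : Finset V}
    (hQB : Q ⊆ B) (hPB' : P ⊆ B') (hG : ∀ x ∈ P, ∀ w ∈ Q, G.Adj x w)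
    (hD : ∀ v, (G \ H).degree v ≤ D) (hQ : D + 4 ≤ Q.card) (hP : 2 ≤ P.card) :
    AreLinked H B B' := by
  refine ⟨P, hPB', hP, fun x hx => ?_⟩
  have := card_le_card_filter_adj_add_degree_sdiff (H := H) (hG x hx)
  have := Finset.card_le_card (Finset.filter_subset_filter (H.Adj x) hQB)
  have := hD x
  omega

end DenseCells

section Snake

variable {α β : Type*}

/-- The boustrophedon through the product of two lists: each row is traversed in the direction
opposite to the previous one. -/
def snake : List α → List β → List (α × β)
  | [], _ => []
  | a :: l, m => m.map (a, ·) ++ snake l m.reverse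

lemma mem_snake {p : α × β} : ∀ {l : List α} {m : List β}, p ∈ snake l m ↔ p.1 ∈ l ∧ p.2 ∈ m
  | [], m => by simp [snake]
  | a :: l, m => by
    obtain ⟨x, y⟩ := p
    rw [snake, List.mem_append, mem_snake]
    grind

lemma nodup_snake : ∀ {l : List α} {m : List β}, l.Nodup → m.Nodup → (snake l m).Nodup
  | [], _, _, _ => List.nodup_nil
  | a :: l, m, hl, hm => by
    obtain ⟨ha, hl⟩ := List.nodup_cons.1 hl
    refine (hm.map (Prod.mk_right_injective a)).append (nodup_snake hl (List.nodup_reverse.2 hm)) ?_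
    rintro p hp hp'
    obtain ⟨b, -, rfl⟩ := List.mem_map.1 hp
    exact ha (mem_snake.1 hp').1

lemma head?_snake (a : α) (l : List α) {m : List β} (hm : m ≠ []) :
    (snake (a :: l) m).head? = m.head?.map (a, ·) := by
  obtain ⟨b, m, rfl⟩ := List.exists_cons_of_ne_nil hm
  rfl

lemma isChain_snake {G : SimpleGraph α} {H : SimpleGraph β} : ∀ {l : List α} {m : List β},
    l.IsChain G.Adj → m.IsChain H.Adj → (snake l m).IsChain (G □ H).Adj
  | [], _, _, _ => .nil
  | [a], m, _, hm => by
    simpa [snake, List.isChain_map, SimpleGraph.boxProd_adj] using hm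
  | a :: a' :: l, m, hl, hm => by
    have hrev : m.reverse.IsChain H.Adj := by
      simpa [List.isChain_reverse, flip, H.adj_comm] using hm
    have hrow : (m.map (a, ·)).IsChain (G □ H).Adj := by
      simpa [List.isChain_map, SimpleGraph.boxProd_adj] using hm
    refine hrow.append (isChain_snake (List.isChain_cons_cons.1 hl).2 hrev) ?_
    rw [List.getLast?_map]
    rintro _ hx _ hy
    obtain ⟨b, hb, rfl⟩ := Option.mem_map.1 hx
    have hne : m ≠ [] := by rintro rfl; simp at hb
    rw [head?_snake _ _ (by simpa), List.head?_reverse] at hy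
    obtain ⟨b', hb', rfl⟩ := Option.mem_map.1 hy
    obtain rfl := Option.mem_unique hb hb'
    exact SimpleGraph.boxProd_adj.2 (.inl ⟨(List.isChain_cons_cons.1 hl).1, rfl⟩)

/-- The graph of the `d`-dimensional grid with side length `L`. -/
def gridGraph (d L : ℕ) : SimpleGraph (Fin d → Fin L) where
  Adj p q := ∃ j, (∀ i ≠ j, p i = q i) ∧ (SimpleGraph.pathGraph L).Adj (p j) (q j)
  symm := ⟨fun _ _ ⟨j, h, hj⟩ => ⟨j, fun i hi => (h i hi).symm, hj.symm⟩⟩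
  loopless := ⟨fun _ ⟨_, _, hj⟩ => hj.ne rfl⟩

lemma gridGraph_adj_cons {d L : ℕ} {a b : Fin L} {p q : Fin d → Fin L}
    (h : (SimpleGraph.pathGraph L □ gridGraph d L).Adj (a, p) (b, q)) :
    (gridGraph (d + 1) L).Adj (Fin.cons a p) (Fin.cons b q) := by
  rcases SimpleGraph.boxProd_adj.1 h with ⟨hab, rfl⟩ | ⟨⟨j, hj, hpq⟩, rfl⟩
  · exact ⟨0, fun i hi => by cases i using Fin.cases <;> simp_all, by simpa using hab⟩
  · refine ⟨j.succ, fun i hi => ?_, by simpa using hpq⟩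
    cases i using Fin.cases with
    | zero => simp
    | succ i => simpa using hj i (by simpa using hi)

lemma isPathOn_pathGraph_finRange (L : ℕ) :
    IsPathOn (SimpleGraph.pathGraph L) Set.univ (List.finRange L) where
  nodup := List.nodup_finRange L
  mem_iff := by simp
  isChain := by
    rw [List.isChain_iff_getElem]
    intro i hi
    simp [SimpleGraph.pathGraph_adj]

lemma exists_isPathOn_gridGraph (L : ℕ) :
    ∀ d : ℕ, ∃ l, IsPathOn (gridGraph d L) Set.univ l
  | 0 => ⟨[Fin.elim0], by simp, fun p => by simp [Subsingleton.elim p Fin.elim0], by simp⟩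
  | d + 1 => by
    obtain ⟨l, hl⟩ := exists_isPathOn_gridGraph L d
    have hL := isPathOn_pathGraph_finRange L
    refine ⟨(snake (List.finRange L) l).map fun p => Fin.cons p.1 p.2, ?_, fun p => ?_, ?_⟩
    · refine (nodup_snake hL.nodup hl.nodup).map fun p q h => ?_
      exact Prod.ext_iff.2 (Fin.cons_inj.1 h)
    · simp only [List.mem_map, mem_snake, Set.mem_univ, iff_true]
      exact ⟨(p 0, Fin.tail p), by simp [hl.mem_iff], Fin.cons_self_tail p⟩
    · rw [List.isChain_map]
      exact (isChain_snake hL.isChain hl.isChain).imp fun _ _ => gridGraph_adj_cons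

end Snake

section Chernoff

variable {ι E : Type*} [Fintype ι]

open Classical in
/-- The indices of the members of the family `x` that lie in `S`. -/
noncomputable def pointsIn (x : ι → E) (S : Set E) : Finset ι := {i | x i ∈ S}

@[simp]
lemma mem_pointsIn {x : ι → E} {S : Set E} {i : ι} : i ∈ pointsIn x S ↔ x i ∈ S := by
  simp [pointsIn]

lemma pointsIn_mono (x : ι → E) {S T : Set E} (hST : S ⊆ T) : pointsIn x S ⊆ pointsIn x T :=
  fun _ hi => mem_pointsIn.2 (hST (mem_pointsIn.1 hi))

lemma card_pointsIn_eq_sum_indicator (x : ι → E) (S : Set E) :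
    ((pointsIn x S).card : ℝ) = ∑ i, S.indicator 1 (x i) := by
  classical
  simp [pointsIn, Set.indicator_apply]

variable [MeasurableSpace E] {S : Set E}

lemma measurable_card_pointsIn (hS : MeasurableSet S) :
    Measurable fun x : ι → E => ((pointsIn x S).card : ℝ) := by
  simp only [card_pointsIn_eq_sum_indicator]
  exact Finset.measurable_sum _ fun i _ =>
    (measurable_one.indicator hS).comp (measurable_pi_apply i)

variable (μ : Measure E) [IsProbabilityMeasure μ]

lemma mgf_card_pointsIn (hS : MeasurableSet S) (t : ℝ) :
    ProbabilityTheory.mgf (fun x : ι → E => ((pointsIn x S).card : ℝ)) (Measure.pi fun _ => μ) t =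
      (1 + (Real.exp t - 1) * μ.real S) ^ Fintype.card ι := by
  have hprod : ∀ x : ι → E, Real.exp (t * (pointsIn x S).card) =
      ∏ i, (1 + S.indicator (fun _ => Real.exp t - 1) (x i)) := by
    intro x
    rw [card_pointsIn_eq_sum_indicator, Finset.mul_sum, Real.exp_sum]
    refine Finset.prod_congr rfl fun i _ => ?_
    by_cases h : x i ∈ S <;> simp [h]
  simp only [ProbabilityTheory.mgf, hprod]
  rw [integral_fintype_prod_eq_pow (fun y => 1 + S.indicator (fun _ => Real.exp t - 1) y),
    integral_add (integrable_const _) ((integrable_const _).indicator hS),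
    integral_indicator_const _ hS]
  simp [mul_comm]

lemma integrable_exp_mul_card_pointsIn (hS : MeasurableSet S) (t : ℝ) :
    Integrable (fun x : ι → E => Real.exp (t * (pointsIn x S).card)) (Measure.pi fun _ => μ) := by
  refine Integrable.of_bound (C := Real.exp (|t| * Fintype.card ι))
    ((measurable_card_pointsIn hS).const_mul t).exp.aestronglyMeasurable (.of_forall fun x => ?_)
  rw [Real.norm_eq_abs, Real.abs_exp, Real.exp_le_exp]
  gcongr
  · exact le_abs_self t
  · exact Finset.card_le_univ _

lemma mgf_card_pointsIn_le (hS : MeasurableSet S) {t : ℝ} (ht : |t| ≤ 1) :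
    ProbabilityTheory.mgf (fun x : ι → E => ((pointsIn x S).card : ℝ)) (Measure.pi fun _ => μ) t ≤
      Real.exp ((t + t ^ 2) * (Fintype.card ι * μ.real S)) := by
  have hexp : Real.exp t - 1 ≤ t + t ^ 2 := by
    linarith [(abs_le.1 (Real.abs_exp_sub_one_sub_id_le ht)).2]
  have hbase : 0 ≤ 1 + (Real.exp t - 1) * μ.real S := by
    nlinarith [Real.exp_pos t, measureReal_le_one (μ := μ) (s := S),
      measureReal_nonneg (μ := μ) (s := S)]
  calc _ = (1 + (Real.exp t - 1) * μ.real S) ^ Fintype.card ι := mgf_card_pointsIn μ hS t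
    _ ≤ Real.exp ((t + t ^ 2) * μ.real S) ^ Fintype.card ι := by
      gcongr
      refine le_trans ?_ (Real.add_one_le_exp _)
      rw [add_comm]
      gcongr
    _ = _ := by rw [← Real.exp_nat_mul]; ring_nf

lemma card_pointsIn_upper_tail (hS : MeasurableSet S) {m δ : ℝ} (hδ : 0 ≤ δ) (hδ' : δ ≤ 2)
    (hm : Fintype.card ι * μ.real S ≤ m) :
    (Measure.pi fun _ : ι => μ).real {x | (1 + δ) * m ≤ (pointsIn x S).card} ≤
      Real.exp (-(δ ^ 2 / 4 * m)) := by
  have ht : |δ / 2| ≤ 1 := by rw [abs_of_nonneg (by positivity)]; linarith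
  calc _ ≤ Real.exp (-(δ / 2) * ((1 + δ) * m)) *
        Real.exp ((δ / 2 + (δ / 2) ^ 2) * (Fintype.card ι * μ.real S)) := by
        refine (ProbabilityTheory.measure_ge_le_exp_mul_mgf (t := δ / 2) _ (by positivity)
          (integrable_exp_mul_card_pointsIn μ hS _)).trans ?_
        gcongr
        exact mgf_card_pointsIn_le (ι := ι) μ hS ht
    _ ≤ Real.exp (-(δ / 2) * ((1 + δ) * m)) * Real.exp ((δ / 2 + (δ / 2) ^ 2) * m) := by gcongr
    _ = _ := by rw [← Real.exp_add]; ring_nf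

lemma card_pointsIn_lower_tail (hS : MeasurableSet S) {m δ : ℝ} (hδ : 0 ≤ δ) (hδ' : δ ≤ 2)
    (hm : m = Fintype.card ι * μ.real S) :
    (Measure.pi fun _ : ι => μ).real {x | (pointsIn x S).card ≤ (1 - δ) * m} ≤
      Real.exp (-(δ ^ 2 / 4 * m)) := by
  have ht : |-(δ / 2)| ≤ 1 := by rw [abs_neg, abs_of_nonneg (by positivity)]; linarith
  calc _ ≤ Real.exp (- -(δ / 2) * ((1 - δ) * m)) *
        Real.exp ((-(δ / 2) + (-(δ / 2)) ^ 2) * (Fintype.card ι * μ.real S)) := by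
        refine (ProbabilityTheory.measure_le_le_exp_mul_mgf (t := -(δ / 2)) _ (by linarith)
          (integrable_exp_mul_card_pointsIn μ hS _)).trans ?_
        gcongr
        exact mgf_card_pointsIn_le (ι := ι) μ hS ht
    _ = _ := by rw [← hm, ← Real.exp_add]; ring_nf

lemma card_pointsIn_removeNth_upper_tail {S : E → Set E}
    (hS : MeasurableSet {z : E × E | z.2 ∈ S z.1}) {n : ℕ} {m δ : ℝ} (hδ : 0 ≤ δ) (hδ' : δ ≤ 2)
    (hm : ∀ y, n * μ.real (S y) ≤ m) (v : Fin (n + 1)) :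
    (Measure.pi fun _ : Fin (n + 1) => μ).real
      {x | (1 + δ) * m ≤ (pointsIn (v.removeNth x) (S (x v))).card} ≤
      Real.exp (-(δ ^ 2 / 4 * m)) := by
  let W : Set (E × (Fin n → E)) := {z | (1 + δ) * m ≤ (pointsIn z.2 (S z.1)).card}
  have hW : MeasurableSet W := by
    refine measurableSet_le measurable_const ?_
    simp only [card_pointsIn_eq_sum_indicator]
    refine Finset.measurable_sum _ fun i _ => ?_
    have hpair : Measurable fun z : E × (Fin n → E) => (z.1, z.2 i) := by fun_prop
    exact (measurable_one.indicator hS).comp hpair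
  have hmp := measurePreserving_piFinSuccAbove (fun _ : Fin (n + 1) => μ) v
  refine ENNReal.toReal_le_of_le_ofReal (Real.exp_pos _).le ?_
  calc _ = (μ.prod (Measure.pi fun _ : Fin n => μ)) W := hmp.measure_preimage hW.nullMeasurableSet
    _ = ∫⁻ y, (Measure.pi fun _ : Fin n => μ) (Prod.mk y ⁻¹' W) ∂μ := Measure.prod_apply hW
    _ ≤ ∫⁻ _, ENNReal.ofReal (Real.exp (-(δ ^ 2 / 4 * m))) ∂μ := by
      refine lintegral_mono fun y => ?_
      rw [← ofReal_measureReal]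
      exact ENNReal.ofReal_le_ofReal (card_pointsIn_upper_tail μ (measurable_prodMk_left hS) hδ hδ'
        (by simpa using hm y))
    _ = _ := by simp

end Chernoff

section Grid

variable {d : ℕ}

lemma setOf_forall_mem_eq_preimage (s : Fin d → Set ℝ) :
    {x : EuclideanSpace ℝ (Fin d) | ∀ i, x i ∈ s i} = WithLp.ofLp ⁻¹' Set.univ.pi s := by
  ext x; simp

lemma measurableSet_setOf_forall_mem {s : Fin d → Set ℝ} (hs : ∀ i, MeasurableSet (s i)) :
    MeasurableSet {x : EuclideanSpace ℝ (Fin d) | ∀ i, x i ∈ s i} := by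
  rw [setOf_forall_mem_eq_preimage]
  exact (PiLp.volume_preserving_ofLp (Fin d)).measurable (.univ_pi hs)

lemma volume_setOf_forall_mem {s : Fin d → Set ℝ} (hs : ∀ i, MeasurableSet (s i)) :
    volume {x : EuclideanSpace ℝ (Fin d) | ∀ i, x i ∈ s i} = ∏ i, volume (s i) := by
  rw [setOf_forall_mem_eq_preimage, (PiLp.volume_preserving_ofLp (Fin d)).measure_preimage
    (MeasurableSet.univ_pi hs).nullMeasurableSet, volume_pi_pi]

lemma uniformCube_apply (S : Set (EuclideanSpace ℝ (Fin d))) :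
    uniformCube d S = volume (unitCube d ∩ S) := by
  have hcube : MeasurableSet (unitCube d) :=
    measurableSet_setOf_forall_mem fun _ => measurableSet_Icc
  rw [uniformCube, ProbabilityTheory.cond_apply hcube, volume_unitCube, inv_one, one_mul]

lemma uniformCube_setOf_forall_mem {s : Fin d → Set ℝ} (hs : ∀ i, MeasurableSet (s i))
    (hs' : ∀ i, s i ⊆ Set.Icc 0 1) : uniformCube d {x | ∀ i, x i ∈ s i} = ∏ i, volume (s i) := by
  have hsub : {x : EuclideanSpace ℝ (Fin d) | ∀ i, x i ∈ s i} ⊆ unitCube d :=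
    fun x hx i => hs' i (hx i)
  rw [uniformCube_apply, Set.inter_eq_right.2 hsub, volume_setOf_forall_mem hs]

lemma ae_uniformPoints_mem_Ico (d n : ℕ) :
    ∀ᵐ x ∂uniformPoints d n, ∀ v i, x v i ∈ Set.Ico (0 : ℝ) 1 := by
  have hcube : ∀ᵐ y ∂uniformCube d, ∀ i, y i ∈ Set.Ico (0 : ℝ) 1 := by
    refine (mem_ae_iff_prob_eq_one
      (measurableSet_setOf_forall_mem fun _ => measurableSet_Ico)).2 ?_
    rw [uniformCube_setOf_forall_mem (fun _ => measurableSet_Ico) fun _ => Set.Ico_subset_Icc_self]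
    simp
  exact ae_all_iff.2 fun v =>
    (Measure.quasiMeasurePreserving_eval (μ := fun _ : Fin n => uniformCube d) v).ae hcube

lemma uniformCube_closedBall_le (y : EuclideanSpace ℝ (Fin d)) {r : ℝ} (hr : 0 ≤ r) :
    (uniformCube d).real (Metric.closedBall y r) ≤ unitBallVolume d * r ^ d := by
  rw [measureReal_def, uniformCube_apply]
  refine (ENNReal.toReal_mono measure_closedBall_lt_top.ne
    (measure_mono Set.inter_subset_right)).trans_eq ?_
  rw [Measure.addHaar_closedBall _ _ hr, ENNReal.toReal_mul,
    ENNReal.toReal_ofReal (by positivity), unitBallVolume, finrank_euclideanSpace_fin, mul_comm]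

variable {L : ℕ}

/-- The half-open grid cube of side `1 / L` with index `q`. -/
def gridCell (q : Fin d → Fin L) : Set (EuclideanSpace ℝ (Fin d)) :=
  {x | ∀ i, L * x i - q i ∈ Set.Ico (0 : ℝ) 1}

/-- The lower (`k = 0`) or upper (`k = 1`) half of the grid cube `gridCell q` in direction `j`. -/
def halfCell (q : Fin d → Fin L) (j : Fin d) (k : Fin 2) : Set (EuclideanSpace ℝ (Fin d)) :=
  {x | x ∈ gridCell q ∧ L * x j - q j ∈ Set.Ico (k / 2 : ℝ) ((k + 1) / 2)}

lemma halfCell_subset_gridCell (q : Fin d → Fin L) (j : Fin d) (k : Fin 2) :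
    halfCell q j k ⊆ gridCell q := fun _ hx => hx.1

lemma eq_of_mem_gridCell {q q' : Fin d → Fin L} {x : EuclideanSpace ℝ (Fin d)}
    (hx : x ∈ gridCell q) (hx' : x ∈ gridCell q') : q = q' := by
  have hfloor : ∀ {p : Fin d → Fin L}, x ∈ gridCell p → ∀ i, ⌊L * x i⌋ = (p i : ℤ) :=
    fun hp i => Int.floor_eq_iff.2
      ⟨by push_cast; linarith [(hp i).1], by push_cast; linarith [(hp i).2]⟩
  funext i
  exact Fin.ext (by exact_mod_cast (hfloor hx i).symm.trans (hfloor hx' i))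

lemma exists_mem_gridCell (hL : 0 < L) {x : EuclideanSpace ℝ (Fin d)}
    (hx : ∀ i, x i ∈ Set.Ico (0 : ℝ) 1) : ∃ q : Fin d → Fin L, x ∈ gridCell q := by
  have hpos : ∀ i, 0 ≤ L * x i := fun i => mul_nonneg L.cast_nonneg (hx i).1
  have hlt : ∀ i, ⌊L * x i⌋₊ < L := fun i =>
    (Nat.floor_lt (hpos i)).2 (mul_lt_of_lt_one_right (Nat.cast_pos.2 hL) (hx i).2)
  exact ⟨fun i => ⟨_, hlt i⟩, fun i => ⟨sub_nonneg.2 (Nat.floor_le (hpos i)),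
    sub_lt_iff_lt_add'.2 (Nat.lt_floor_add_one _)⟩⟩

lemma halfCell_eq_setOf_forall_mem (hL : 0 < L) (q : Fin d → Fin L) (j : Fin d) (k : Fin 2) :
    halfCell q j k = {x | ∀ i, x i ∈ if i = j
      then Set.Ico ((q i + k / 2) / L : ℝ) ((q i + (k + 1) / 2) / L)
      else Set.Ico (q i / L : ℝ) ((q i + 1) / L)} := by
  have hk : (k : ℝ) ≤ 1 := by exact_mod_cast Fin.is_le k
  have hk' : (0 : ℝ) ≤ k := Nat.cast_nonneg _
  have hmem : ∀ {t a b : ℝ}, t ∈ Set.Ico (a / L) (b / L) ↔ a ≤ L * t ∧ L * t < b := by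
    intro t a b
    rw [Set.mem_Ico, div_le_iff₀' (by positivity), lt_div_iff₀' (by positivity)]
  ext x
  constructor
  · rintro ⟨h, hj⟩ i
    split_ifs with hij
    · subst hij
      exact hmem.2 ⟨by linarith [hj.1], by linarith [hj.2]⟩
    · exact hmem.2 ⟨by linarith [(h i).1], by linarith [(h i).2]⟩
  · intro h
    have hj := h j
    rw [if_pos rfl, hmem] at hj
    refine ⟨fun i => ?_, by linarith, by linarith⟩
    by_cases hij : i = j
    · subst hij
      exact ⟨by linarith [hk'], by linarith⟩
    · have hi := h i
      rw [if_neg hij, hmem] at hi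
      exact ⟨by linarith, by linarith⟩

lemma measurableSet_halfCell (hL : 0 < L) (q : Fin d → Fin L) (j : Fin d) (k : Fin 2) :
    MeasurableSet (halfCell q j k) := by
  rw [halfCell_eq_setOf_forall_mem hL]
  refine measurableSet_setOf_forall_mem fun i => ?_
  split_ifs <;> exact measurableSet_Ico

lemma uniformCube_halfCell (hL : 0 < L) (q : Fin d → Fin L) (j : Fin d) (k : Fin 2) :
    (uniformCube d).real (halfCell q j k) = 1 / (2 * L ^ d) := by
  have hk : (k : ℝ) ≤ 1 := by exact_mod_cast Fin.is_le k
  have hq : ∀ i, (q i : ℝ) + 1 ≤ L := fun i => by exact_mod_cast (q i).is_lt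
  have hside : ∀ {a b : ℝ}, a ≤ b → (volume (Set.Ico (a / L) (b / L))).toReal = (b - a) / L := by
    intro a b hab
    rw [Real.volume_Ico, ← sub_div,
      ENNReal.toReal_ofReal (div_nonneg (sub_nonneg.2 hab) L.cast_nonneg)]
  rw [halfCell_eq_setOf_forall_mem hL, measureReal_def, uniformCube_setOf_forall_mem]
  · have hvol : ∀ i, (volume (if i = j
        then Set.Ico ((q i + k / 2) / L : ℝ) ((q i + (k + 1) / 2) / L)
        else Set.Ico (q i / L : ℝ) ((q i + 1) / L))).toReal =
          (if i = j then 1 / 2 else 1) * (1 / L) := by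
      intro i
      split_ifs <;> rw [hside (by linarith)] <;> ring
    rw [ENNReal.toReal_prod, Finset.prod_congr rfl fun i _ => hvol i, Finset.prod_mul_distrib,
      Finset.prod_ite_eq', Finset.prod_const, Finset.card_univ, Fintype.card_fin]
    simp [mul_comm]
  · intro i
    split_ifs <;> exact measurableSet_Ico
  · intro i
    split_ifs <;> refine Set.Ico_subset_Icc_self.trans (Set.Icc_subset_Icc (by positivity) ?_) <;>
      rw [div_le_one (by positivity)] <;> linarith [hq i]

lemma norm_sub_le_of_forall_abs_le (hL : 0 < L) {r : ℝ} (hr : √d ≤ r * L)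
    {x y : EuclideanSpace ℝ (Fin d)} (h : ∀ i, |L * x i - L * y i| ≤ 1) : ‖x - y‖ ≤ r := by
  have hscaled : ‖(L : ℝ) • (x - y)‖ ≤ √d := by
    rw [EuclideanSpace.norm_eq]
    refine Real.sqrt_le_sqrt ((Finset.sum_le_card_nsmul _ _ 1 fun i _ => ?_).trans (by simp))
    simpa [mul_sub] using h i
  rw [norm_smul, Real.norm_natCast, mul_comm] at hscaled
  exact le_of_mul_le_mul_right (hscaled.trans hr) (by positivity)

lemma abs_sub_le_one_of_mem_gridCell {q : Fin d → Fin L} {x y : EuclideanSpace ℝ (Fin d)}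
    (hx : x ∈ gridCell q) (hy : y ∈ gridCell q) (i : Fin d) : |L * x i - L * y i| ≤ 1 := by
  rw [abs_le]
  constructor <;> linarith [(hx i).1, (hx i).2, (hy i).1, (hy i).2]

lemma abs_sub_le_one_of_mem_halfCell {q q' : Fin d → Fin L} {j : Fin d}
    (hq : ∀ i ≠ j, q i = q' i) (hj : (q j : ℕ) + 1 = q' j) {x y : EuclideanSpace ℝ (Fin d)}
    (hx : x ∈ halfCell q j 1) (hy : y ∈ halfCell q' j 0) (i : Fin d) :
    |L * x i - L * y i| ≤ 1 := by
  by_cases hi : i = j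
  · subst hi
    have hj' : (q i : ℝ) + 1 = q' i := by exact_mod_cast hj
    obtain ⟨hx₁, hx₂⟩ := hx.2
    obtain ⟨hy₁, hy₂⟩ := hy.2
    norm_num at hx₁ hx₂ hy₁ hy₂
    rw [abs_le]
    constructor <;> linarith
  · have hx' := hx.1 i
    rw [hq i hi] at hx'
    rw [abs_le]
    constructor <;> linarith [hx'.1, hx'.2, (hy.1 i).1, (hy.1 i).2]

lemma isClique_pointsIn_gridCell (hL : 0 < L) {r : ℝ} (hr : √d ≤ r * L) {n : ℕ}
    (x : Fin n → EuclideanSpace ℝ (Fin d)) (q : Fin d → Fin L) :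
    (geometricGraph r x).IsClique (pointsIn x (gridCell q)) := by
  intro u hu v hv huv
  rw [Finset.mem_coe, mem_pointsIn] at hu hv
  exact ⟨huv, norm_sub_le_of_forall_abs_le hL hr (abs_sub_le_one_of_mem_gridCell hu hv)⟩

lemma disjoint_pointsIn_gridCell {ι : Type*} [Fintype ι] (x : ι → EuclideanSpace ℝ (Fin d))
    {q q' : Fin d → Fin L} (hqq' : q ≠ q') :
    Disjoint (pointsIn x (gridCell q)) (pointsIn x (gridCell q')) :=
  Finset.disjoint_left.2 fun _ hv hv' =>
    hqq' (eq_of_mem_gridCell (mem_pointsIn.1 hv) (mem_pointsIn.1 hv'))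

lemma card_halfCell_add_card_halfCell_le {ι : Type*} [Fintype ι]
    (x : ι → EuclideanSpace ℝ (Fin d)) (q : Fin d → Fin L) (j : Fin d) :
    (pointsIn x (halfCell q j 0)).card + (pointsIn x (halfCell q j 1)).card ≤
      (pointsIn x (gridCell q)).card := by
  classical
  have hdisj : Disjoint (pointsIn x (halfCell q j 0)) (pointsIn x (halfCell q j 1)) := by
    refine Finset.disjoint_left.2 fun v hv hv' => ?_
    have hlt := (mem_pointsIn.1 hv).2.2
    have hle := (mem_pointsIn.1 hv').2.1
    norm_num at hlt hle
    linarith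
  rw [← Finset.card_union_of_disjoint hdisj]
  refine Finset.card_le_card (Finset.union_subset ?_ ?_) <;>
    exact pointsIn_mono x (halfCell_subset_gridCell q j _)

variable {n D : ℕ} {r : ℝ} {x : Fin n → EuclideanSpace ℝ (Fin d)} {H : SimpleGraph (Fin n)}

open Classical in
lemma areLinked_of_halfCell (hL : 0 < L) (hr : √d ≤ r * L)
    (hcount : ∀ (q : Fin d → Fin L) j k, D + 4 ≤ (pointsIn x (halfCell q j k)).card)
    (hD : ∀ v, (geometricGraph r x \ H).degree v ≤ D) {q q' : Fin d → Fin L} {j : Fin d}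
    {k k' : Fin 2} (hqq' : q ≠ q')
    (hclose : ∀ y ∈ halfCell q j k, ∀ z ∈ halfCell q' j k', ∀ i, |L * y i - L * z i| ≤ 1) :
    AreLinked H (pointsIn x (gridCell q)) (pointsIn x (gridCell q')) := by
  have hsub : ∀ (p : Fin d → Fin L) k, pointsIn x (halfCell p j k) ⊆ pointsIn x (gridCell p) :=
    fun p k => pointsIn_mono x (halfCell_subset_gridCell p j k)
  refine areLinked_of_forall_adj (hsub q k) (hsub q' k') (fun v hv w hw => ?_) hD
    (hcount q j k) (le_trans (by omega) (hcount q' j k'))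
  have hne : w ≠ v := Finset.disjoint_iff_ne.1 (disjoint_pointsIn_gridCell x hqq') w
    (hsub q k hw) v (hsub q' k' hv)
  have hadj : (geometricGraph r x).Adj w v := ⟨hne, norm_sub_le_of_forall_abs_le hL hr
    (hclose _ (mem_pointsIn.1 hw) _ (mem_pointsIn.1 hv))⟩
  exact hadj.symm

open Classical in
lemma areLinked_of_gridGraph_adj (hL : 0 < L) (hr : √d ≤ r * L)
    (hcount : ∀ (q : Fin d → Fin L) j k, D + 4 ≤ (pointsIn x (halfCell q j k)).card)
    (hD : ∀ v, (geometricGraph r x \ H).degree v ≤ D) {q q' : Fin d → Fin L}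
    (hqq' : (gridGraph d L).Adj q q') :
    AreLinked H (pointsIn x (gridCell q)) (pointsIn x (gridCell q')) := by
  have hne := hqq'.ne
  obtain ⟨j, hq, hj⟩ := hqq'
  rcases SimpleGraph.pathGraph_adj.1 hj with hj | hj
  · exact areLinked_of_halfCell hL hr hcount hD hne
      fun y hy z hz => abs_sub_le_one_of_mem_halfCell hq hj hy hz
  · refine areLinked_of_halfCell (j := j) (k := 0) (k' := 1) hL hr hcount hD hne
      fun y hy z hz i => ?_
    rw [abs_sub_comm]
    exact abs_sub_le_one_of_mem_halfCell (fun i hi => (hq i hi).symm) hj hz hy i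

open Classical in
lemma isHamiltonian_of_halfCell (hd : 0 < d) (hL : 0 < L) (hr : √d ≤ r * L)
    (hx : ∀ v i, x v i ∈ Set.Ico (0 : ℝ) 1)
    (hcount : ∀ (q : Fin d → Fin L) j k, D + 4 ≤ (pointsIn x (halfCell q j k)).card)
    (hD : ∀ v, (geometricGraph r x \ H).degree v ≤ D) : H.IsHamiltonian := by
  obtain ⟨l, hnodup, hmem, hchain⟩ := exists_isPathOn_gridGraph L d
  refine isHamiltonian_of_isChain_areLinked (Bs := l.map fun q => pointsIn x (gridCell q))
    ?_ ?_ ?_ ?_ ?_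
  · exact List.ne_nil_of_mem (List.mem_map_of_mem ((hmem fun _ => ⟨0, hL⟩).2 trivial))
  · refine List.forall_mem_map.2 fun q _ => ?_
    refine isDenseCell_of_isClique (isClique_pointsIn_gridCell hL hr x q) hD ?_
    have := card_halfCell_add_card_halfCell_le x q ⟨0, hd⟩
    have := hcount q ⟨0, hd⟩
    linarith [this 0, this 1]
  · exact List.pairwise_map.2 (hnodup.imp (disjoint_pointsIn_gridCell x))
  · rw [List.isChain_map]
    exact hchain.imp fun _ _ => areLinked_of_gridGraph_adj hL hr hcount hD
  · intro v
    obtain ⟨q, hq⟩ := exists_mem_gridCell hL (hx v)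
    exact ⟨_, List.mem_map_of_mem ((hmem q).2 trivial), mem_pointsIn.2 hq⟩

end Grid

section Resilience

/-- `G` is `α`-resiliently Hamiltonian: all its `α`-subgraphs are Hamiltonian. -/
def IsResilientlyHamiltonian {V : Type*} [Fintype V] [DecidableEq V] (α : ℝ)
    (G : SimpleGraph V) : Prop :=
  ∀ H : SimpleGraph V, IsAlphaSubgraph α H G → H.IsHamiltonian

open Classical in
lemma IsAlphaSubgraph.degree_sdiff_le {V : Type*} [Fintype V] {α : ℝ} {H G : SimpleGraph V}
    (h : IsAlphaSubgraph α H G) (v : V) : ((G \ H).degree v : ℝ) ≤ (1 - α) * G.degree v := by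
  have hsub : H.neighborFinset v ⊆ G.neighborFinset v := fun u => by
    simpa using fun hu => h.1 hu
  have hcard : (G \ H).degree v + H.degree v = G.degree v := by
    simp only [← SimpleGraph.card_neighborFinset_eq_degree]
    rw [← Finset.card_sdiff_add_card_eq_card hsub]
    congr 2
    ext u
    simp
  have hcast : ((G \ H).degree v : ℝ) + H.degree v = G.degree v := by exact_mod_cast hcard
  linarith [h.2 v]

variable {d L n : ℕ} {r α β δ : ℝ}

open Classical in
lemma isResilientlyHamiltonian_of_halfCell (hd : 0 < d) (hL : 0 < L) (hr : √d ≤ r * L)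
    {x : Fin n → EuclideanSpace ℝ (Fin d)} (hx : ∀ v i, x v i ∈ Set.Ico (0 : ℝ) 1) {K : ℝ}
    (hK : 0 ≤ K) (hdeg : ∀ v, (1 - α) * (geometricGraph r x).degree v ≤ K)
    (hcount : ∀ (q : Fin d → Fin L) j k, K + 4 ≤ (pointsIn x (halfCell q j k)).card) :
    IsResilientlyHamiltonian α (geometricGraph r x) := by
  refine fun H hH => isHamiltonian_of_halfCell (D := ⌊K⌋₊) hd hL hr hx (fun q j k => ?_)
    fun v => Nat.le_floor ((hH.degree_sdiff_le v).trans (hdeg v))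
  have hle : ((⌊K⌋₊ + 4 : ℕ) : ℝ) ≤ (pointsIn x (halfCell q j k)).card := by
    push_cast
    linarith [Nat.floor_le hK, hcount q j k]
  exact_mod_cast hle

open Classical in
lemma degree_geometricGraph_le (r : ℝ) (x : Fin (n + 1) → EuclideanSpace ℝ (Fin d))
    (v : Fin (n + 1)) : (geometricGraph r x).degree v ≤
      (pointsIn (v.removeNth x) (Metric.closedBall (x v) r)).card := by
  rw [← SimpleGraph.card_neighborFinset_eq_degree, ← Finset.card_map v.succAboveEmb]
  refine Finset.card_le_card fun u hu => ?_
  obtain ⟨hne, hdist⟩ := (SimpleGraph.mem_neighborFinset _ _ _).1 hu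
  obtain ⟨w, rfl⟩ := Fin.exists_succAbove_eq hne.symm
  exact Finset.mem_map.2 ⟨w, mem_pointsIn.2 (mem_closedBall_iff_norm'.2 hdist), rfl⟩

lemma uniformPoints_exists_card_halfCell_le (hL : 0 < L) (hδ : 0 ≤ δ) (hδ' : δ ≤ 2) :
    (uniformPoints d n).real {x | ∃ (q : Fin d → Fin L) (j : Fin d) (k : Fin 2),
        (pointsIn x (halfCell q j k)).card ≤ (1 - δ) * (n * (1 / (2 * L ^ d)))} ≤
      2 * d * L ^ d * Real.exp (-(δ ^ 2 / 4 * (n * (1 / (2 * L ^ d))))) := by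
  have hunion : {x : Fin n → EuclideanSpace ℝ (Fin d) |
      ∃ (q : Fin d → Fin L) (j : Fin d) (k : Fin 2),
        (pointsIn x (halfCell q j k)).card ≤ (1 - δ) * (n * (1 / (2 * L ^ d)))} =
      ⋃ c : (Fin d → Fin L) × Fin d × Fin 2,
        {x | (pointsIn x (halfCell c.1 c.2.1 c.2.2)).card ≤ (1 - δ) * (n * (1 / (2 * L ^ d)))} := by
    ext x
    simp
  rw [hunion]
  refine (measureReal_iUnion_fintype_le _).trans
    ((Finset.sum_le_card_nsmul _ _ _ fun c _ => card_pointsIn_lower_tail (uniformCube d)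
      (measurableSet_halfCell hL c.1 c.2.1 c.2.2) hδ hδ' ?_).trans_eq ?_)
  · rw [uniformCube_halfCell hL, Fintype.card_fin]
  · simp
    ring

open Classical in
lemma uniformPoints_exists_le_degree (hr : 0 ≤ r) (hδ : 0 ≤ δ) (hδ' : δ ≤ 2) :
    (uniformPoints d n).real {x | ∃ v, (1 + δ) * (n * (unitBallVolume d * r ^ d)) ≤
        (geometricGraph r x).degree v} ≤
      n * Real.exp (-(δ ^ 2 / 4 * (n * (unitBallVolume d * r ^ d)))) := by
  cases n with
  | zero => simp
  | succ n =>
    have hball : MeasurableSet {z : EuclideanSpace ℝ (Fin d) × EuclideanSpace ℝ (Fin d) |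
        z.2 ∈ Metric.closedBall z.1 r} :=
      measurableSet_le (measurable_snd.dist measurable_fst) measurable_const
    have hmean : ∀ y, n * (uniformCube d).real (Metric.closedBall y r) ≤
        (n + 1 : ℕ) * (unitBallVolume d * r ^ d) := fun y => by
      gcongr
      · exact n.le_succ
      · exact uniformCube_closedBall_le y hr
    rw [Set.ofPred_exists]
    refine (measureReal_iUnion_fintype_le _).trans
      ((Finset.sum_le_card_nsmul _ _ _ fun v _ => (measureReal_mono fun x hx => ?_).trans
        (card_pointsIn_removeNth_upper_tail (uniformCube d) hball hδ hδ' hmean v)).trans_eq ?_)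
    · rw [Set.mem_ofPred_eq] at hx ⊢
      exact hx.trans (Nat.cast_le.2 (degree_geometricGraph_le r x v))
    · simp

lemma uniformPoints_not_isResilientlyHamiltonian_le (hd : 0 < d) (hL : 0 < L) (hr : 0 ≤ r)
    (hrL : √d ≤ r * L) (hβ : 0 ≤ β) (hαβ : 1 - α ≤ β) (hδ : 0 ≤ δ) (hδ' : δ ≤ 2)
    (hroom : β * ((1 + δ) * (n * (unitBallVolume d * r ^ d))) + 4 ≤
      (1 - δ) * (n * (1 / (2 * L ^ d)))) :
    (uniformPoints d n).real {x | ¬ IsResilientlyHamiltonian α (geometricGraph r x)} ≤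
      2 * d * L ^ d * Real.exp (-(δ ^ 2 / 4 * (n * (1 / (2 * L ^ d))))) +
        n * Real.exp (-(δ ^ 2 / 4 * (n * (unitBallVolume d * r ^ d)))) := by
  classical
  have hθ : 0 ≤ unitBallVolume d := ENNReal.toReal_nonneg
  refine le_trans ?_ ((measureReal_union_le _ _).trans (add_le_add
    (uniformPoints_exists_card_halfCell_le hL hδ hδ') (uniformPoints_exists_le_degree hr hδ hδ')))
  refine ENNReal.toReal_mono (measure_ne_top _ _) (measure_mono_ae ?_)
  filter_upwards [ae_uniformPoints_mem_Ico d n] with x hx hnot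
  by_contra hgood
  obtain ⟨hcount, hdeg⟩ := not_or.1 hgood
  refine hnot (isResilientlyHamiltonian_of_halfCell hd hL hrL hx (by positivity) (fun v => ?_)
    fun q j k => hroom.trans ?_)
  · exact (mul_le_mul_of_nonneg_right hαβ (Nat.cast_nonneg _)).trans
      (mul_le_mul_of_nonneg_left (not_le.1 fun h => hdeg ⟨v, h⟩).le hβ)
  · exact (not_le.1 fun h => hcount ⟨q, j, k, h⟩).le

end Resilience

section Asymptotics

variable {d L n : ℕ} {r α β δ M : ℝ}

lemma unitBallVolume_pos (d : ℕ) : 0 < unitBallVolume d :=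
  ENNReal.toReal_pos (Metric.measure_ball_pos _ _ one_pos).ne' measure_ball_lt_top.ne

lemma exp_neg_le_of_two_mul_log_le (hn : 0 < n) {t : ℝ} (ht : 2 * Real.log n ≤ t) :
    Real.exp (-t) ≤ 1 / (n : ℝ) ^ 2 := by
  calc Real.exp (-t) ≤ Real.exp (-(2 * Real.log n)) := by gcongr
    _ = 1 / (n : ℝ) ^ 2 := by
      rw [Real.exp_neg, mul_comm, Real.exp_mul, Real.exp_log (by positivity), Real.rpow_two,
        one_div]

lemma uniformPoints_not_isResilientlyHamiltonian_le_div (hd : 0 < d) (hn : 0 < n) (hr : 0 < r)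
    (hrL : √d ≤ r * L) (hM : (r * L) ^ d ≤ M) (hβ : 0 ≤ β) (hαβ : 1 - α ≤ β) (hδ : 0 ≤ δ)
    (hδ' : δ ≤ 1) (hpos : 1 ≤ n * r ^ d)
    (hroom : (1 + δ) * (β * unitBallVolume d) * (n * r ^ d) + 4 ≤
      (1 - δ) / (2 * M) * (n * r ^ d))
    (hcell : 2 * Real.log n ≤ δ ^ 2 / (8 * M) * (n * r ^ d))
    (hball : 2 * Real.log n ≤ δ ^ 2 * unitBallVolume d / 4 * (n * r ^ d)) :
    (uniformPoints d n).real {x | ¬ IsResilientlyHamiltonian α (geometricGraph r x)} ≤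
      (2 * d * M + 1) / n := by
  have hrL₀ : 0 < r * L := (Real.sqrt_pos.2 (by positivity)).trans_le hrL
  have hL : 0 < L := Nat.cast_pos.1 (pos_of_mul_pos_right hrL₀ hr.le)
  have hM₀ : 0 < M := (pow_pos hrL₀ d).trans_le hM
  have hmean : n * r ^ d / (2 * M) ≤ n * (1 / (2 * L ^ d)) := by
    rw [mul_one_div, div_le_div_iff₀ (by positivity) (by positivity)]
    calc n * r ^ d * (2 * L ^ d) = 2 * n * (r * L) ^ d := by ring
      _ ≤ 2 * n * M := by gcongr
      _ = n * (2 * M) := by ring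
  have hcells : (L : ℝ) ^ d ≤ n * M := by
    calc (L : ℝ) ^ d ≤ L ^ d * (n * r ^ d) := le_mul_of_one_le_right (by positivity) hpos
      _ = n * (r * L) ^ d := by ring
      _ ≤ n * M := by gcongr
  refine (uniformPoints_not_isResilientlyHamiltonian_le hd hL hr.le hrL hβ hαβ hδ
    (hδ'.trans one_le_two) ?_).trans ?_
  · calc _ = (1 + δ) * (β * unitBallVolume d) * (n * r ^ d) + 4 := by ring
      _ ≤ (1 - δ) / (2 * M) * (n * r ^ d) := hroom
      _ = (1 - δ) * (n * r ^ d / (2 * M)) := by ring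
      _ ≤ _ := mul_le_mul_of_nonneg_left hmean (sub_nonneg.2 hδ')
  · have htail : Real.exp (-(δ ^ 2 / 4 * (n * (1 / (2 * L ^ d))))) ≤ 1 / (n : ℝ) ^ 2 := by
      refine exp_neg_le_of_two_mul_log_le hn (hcell.trans ?_)
      calc _ = δ ^ 2 / 4 * (n * r ^ d / (2 * M)) := by ring
        _ ≤ _ := by gcongr
    have htail' : Real.exp (-(δ ^ 2 / 4 * (n * (unitBallVolume d * r ^ d)))) ≤ 1 / (n : ℝ) ^ 2 :=
      exp_neg_le_of_two_mul_log_le hn (hball.trans_eq (by ring))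
    calc _ ≤ 2 * d * (n * M) * (1 / (n : ℝ) ^ 2) + n * (1 / (n : ℝ) ^ 2) := by gcongr
      _ = _ := by field_simp

lemma exists_grid_resolution (hd : 0 < d) {c : ℝ} (hc : 1 < c) :
    ∃ ρ > 0, ∀ r, 0 < r → r ≤ ρ → ∃ L : ℕ, √d ≤ r * L ∧ (r * L) ^ d ≤ c * √d ^ d := by
  have hlim : Tendsto (fun r : ℝ => (√d + r) ^ d) (𝓝[>] 0) (𝓝 (√d ^ d)) := by
    refine (Continuous.tendsto' (by fun_prop) _ _ ?_).mono_left nhdsWithin_le_nhds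
    rw [add_zero]
  have hlt : √d ^ d < c * √d ^ d := lt_mul_of_one_lt_left (by positivity) hc
  obtain ⟨ρ, hρc, hρ⟩ := ((hlim.eventually_lt_const hlt).and self_mem_nhdsWithin).exists
  refine ⟨ρ, hρ, fun r hr hrρ => ⟨⌈√d / r⌉₊, ?_, ?_⟩⟩
  · rw [← div_le_iff₀' hr]
    exact Nat.le_ceil _
  · refine le_trans ?_ hρc.le
    gcongr
    calc r * ⌈√d / r⌉₊ ≤ r * (√d / r + 1) := by
          gcongr
          exact (Nat.ceil_lt_add_one (by positivity)).le
      _ = √d + r := by field_simp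
      _ ≤ √d + ρ := by gcongr

lemma exists_one_add_mul_lt {a b : ℝ} (hab : a < b) :
    ∃ δ, 0 < δ ∧ δ < 1 ∧ (1 + δ) * a < (1 - δ) / (1 + δ) * b := by
  have hleft : Tendsto (fun δ : ℝ => (1 + δ) * a) (𝓝[>] 0) (𝓝 a) := by
    refine (Continuous.tendsto' (by fun_prop) _ _ ?_).mono_left nhdsWithin_le_nhds
    simp
  have hright : Tendsto (fun δ : ℝ => (1 - δ) / (1 + δ) * b) (𝓝[>] 0) (𝓝 b) := by
    have hcont : ContinuousAt (fun δ : ℝ => (1 - δ) / (1 + δ) * b) 0 := by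
      fun_prop (disch := norm_num)
    simpa using hcont.tendsto.mono_left nhdsWithin_le_nhds
  obtain ⟨δ, hδ, hδ₀, hδ₁⟩ := ((hleft.eventually_lt hright hab).and
    (Ioo_mem_nhdsGT one_pos)).exists
  exact ⟨δ, hδ₀, hδ₁, hδ⟩

lemma exists_uniformPoints_not_isResilientlyHamiltonian_le (hd : 0 < d)
    (hα : 1 - 1 / (2 * √d ^ d * unitBallVolume d) < α) :
    ∃ C > 0, ∃ ρ > 0, ∃ K : ℝ, ∀ (n : ℕ) (r : ℝ), 1 ≤ Real.log n → 0 < r → r ≤ ρ →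
      C * Real.log n ≤ n * r ^ d →
        (uniformPoints d n).real {x | ¬ IsResilientlyHamiltonian α (geometricGraph r x)} ≤
          K / n := by
  have hθ := unitBallVolume_pos d
  obtain ⟨β, hβ, hαβ, hβθ⟩ : ∃ β, 0 ≤ β ∧ 1 - α ≤ β ∧
      β * unitBallVolume d < 1 / (2 * √d ^ d) := by
    refine ⟨max (1 - α) 0, le_max_right _ _, le_max_left _ _, ?_⟩
    rw [← lt_div_iff₀ hθ, div_div]
    exact max_lt (by linarith) (by positivity)
  obtain ⟨δ, hδ, hδ', hgap⟩ := exists_one_add_mul_lt hβθ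
  obtain ⟨ρ, hρ, hgrid⟩ := exists_grid_resolution hd (lt_add_of_pos_right 1 hδ)
  set M := (1 + δ) * √d ^ d with hM
  have hgap' : (1 + δ) * (β * unitBallVolume d) < (1 - δ) / (2 * M) := by
    refine hgap.trans_eq ?_
    rw [hM]
    field_simp
  have hlarge : ∀ a b : ℝ, 0 < b → ∀ᶠ C in atTop, a ≤ b * C := fun a b hb =>
    (tendsto_id.const_mul_atTop hb).eventually_ge_atTop a
  obtain ⟨C, hC, hC₁, hroom, hcell, hball⟩ := ((eventually_gt_atTop 0).and <|
    (eventually_ge_atTop 1).and <| (hlarge 4 _ (sub_pos.2 hgap')).and <|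
    (hlarge 2 (δ ^ 2 / (8 * M)) (by positivity)).and <|
    hlarge 2 (δ ^ 2 * unitBallVolume d / 4) (by positivity)).exists
  refine ⟨C, hC, ρ, hρ, 2 * d * M + 1, fun n r hlog hr hrρ hn => ?_⟩
  obtain ⟨L, hL, hLM⟩ := hgrid r hr hrρ
  have hscale : ∀ {a b : ℝ}, 0 ≤ b → a ≤ b * C → a * Real.log n ≤ b * (n * r ^ d) := by
    intro a b hb hab
    calc a * Real.log n ≤ b * C * Real.log n := by gcongr
      _ = b * (C * Real.log n) := by ring
      _ ≤ b * (n * r ^ d) := by gcongr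
  refine uniformPoints_not_isResilientlyHamiltonian_le_div hd ?_ hr hL hLM hβ hαβ hδ.le hδ'.le
    ?_ ?_ (hscale (by positivity) hcell) (hscale (by positivity) hball)
  · exact Nat.pos_of_ne_zero fun h => by simp [h] at hlog; linarith
  · linarith [hscale zero_le_one (hC₁.trans_eq (one_mul C).symm)]
  · linarith [hscale (sub_pos.2 hgap').le hroom]

lemma tendsto_measure_one_of_tendsto_compl {ι : Type*} {l : Filter ι} {Ω : ι → Type*}
    [∀ i, MeasurableSpace (Ω i)] {μ : ∀ i, Measure (Ω i)} [∀ i, IsProbabilityMeasure (μ i)]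
    {s : ∀ i, Set (Ω i)} (h : Tendsto (fun i => μ i (s i)ᶜ) l (𝓝 0)) :
    Tendsto (fun i => μ i (s i)) l (𝓝 1) := by
  have hlim : Tendsto (fun i => 1 - μ i (s i)ᶜ) l (𝓝 1) := by
    simpa using ENNReal.Tendsto.sub tendsto_const_nhds h (Or.inl ENNReal.one_ne_top)
  refine tendsto_of_tendsto_of_tendsto_of_le_of_le hlim tendsto_const_nhds (fun i => ?_)
    fun i => prob_le_one
  rw [tsub_le_iff_right, ← measure_univ (μ := μ i)]
  exact measure_univ_le_add_compl (s i)

lemma mul_le_pow_of_rpow_mul_rpow_le (hd : d ≠ 0) {C t : ℝ} (hC : 0 ≤ C) (ht : 0 ≤ t)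
    (h : C ^ (1 / d : ℝ) * t ^ (1 / d : ℝ) ≤ r) : C * t ≤ r ^ d := by
  rw [← Real.mul_rpow hC ht, one_div] at h
  calc C * t = ((C * t) ^ (d : ℝ)⁻¹) ^ d := (Real.rpow_inv_natCast_pow (by positivity) hd).symm
    _ ≤ r ^ d := by gcongr

end Asymptotics

theorem theorem1p8_general (d : ℕ) (hd : 1 ≤ d) {α : ℝ}
    (hα : 1 - 1 / (2 * (d : ℝ) ^ ((d : ℝ) / 2) * unitBallVolume d) < α) :
    ∃ C > 0, ∃ ρ > 0, ∀ r : ℕ → ℝ,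
      (∀ᶠ n : ℕ in atTop, C * (Real.log n / n) ^ (1 / (d : ℝ)) ≤ r n) →
      (∀ᶠ n in atTop, r n ≤ ρ) →
      Tendsto
        (fun n : ℕ => uniformPoints d n
          {x | IsResilientlyHamiltonian α (geometricGraph (r n) x)})
        atTop (𝓝 1) := by
  rw [Real.rpow_div_two_eq_sqrt _ d.cast_nonneg, Real.rpow_natCast] at hα
  obtain ⟨C, hC, ρ, hρ, K, hbound⟩ := exists_uniformPoints_not_isResilientlyHamiltonian_le hd hα
  refine ⟨C ^ (1 / d : ℝ), by positivity, ρ, hρ, fun r hlow hup =>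
    tendsto_measure_one_of_tendsto_compl ?_⟩
  have hlog : ∀ᶠ n : ℕ in atTop, 1 ≤ Real.log n :=
    (Real.tendsto_log_atTop.comp tendsto_natCast_atTop_atTop).eventually_ge_atTop 1
  refine (ENNReal.tendsto_toReal_iff (fun _ => measure_ne_top _ _) ENNReal.zero_ne_top).1
    (squeeze_zero' (.of_forall fun _ => ENNReal.toReal_nonneg) ?_
      (tendsto_const_div_atTop_nhds_zero_nat K))
  filter_upwards [hlow, hup, hlog, eventually_gt_atTop 0] with n hlow hup hlog hn
  have hr : 0 < r n := lt_of_lt_of_le (by positivity) hlow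
  have hpow : C * (Real.log n / n) ≤ r n ^ d :=
    mul_le_pow_of_rpow_mul_rpow_le (by omega) hC.le (by positivity) hlow
  refine hbound n (r n) hlog hr hup ?_
  rwa [← mul_div_assoc, div_le_iff₀' (by positivity)] at hpow

theorem theorem1p8 (d : ℕ) (hd : 1 ≤ d) (ε : ℝ) (hε : 0 < ε)
    (hε' : ε ≤ 1 / (2 * (d : ℝ) ^ ((d : ℝ) / 2) * unitBallVolume d)) :
    ∃ C : ℝ, 0 < C ∧ ∀ r : ℕ → ℝ,
      (∀ᶠ n : ℕ in atTop, C * (Real.log n / n) ^ (1 / (d : ℝ)) ≤ r n) →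
      Tendsto r atTop (𝓝 0) →
      Tendsto
        (fun n : ℕ => uniformPoints d n
          {x | ∀ H : SimpleGraph (Fin n),
            IsAlphaSubgraph (1 - 1 / (2 * (d : ℝ) ^ ((d : ℝ) / 2) * unitBallVolume d) + ε)
              H (geometricGraph (r n) x) → H.IsHamiltonian})
        atTop (𝓝 1) := by
  obtain ⟨C, hC, ρ, hρ, h⟩ := theorem1p8_general d hd (lt_add_of_pos_right _ hε)
  exact ⟨C, hC, fun r hlow hr => h r hlow (hr.eventually_le_const hρ)⟩
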